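/- Let $\Sigma$ be a finite alphabet. For $v\in\mathbb{Z}^2$ let $\sigma_v:\Sigma^{\mathbb{Z}^2}\to\Sigma^{\mathbb{Z}^2}$, $(\sigma_v x)_u=x_{u+v}$, be the shift. A two-dimensional subshift is a closed subset of $\Sigma^{\mathbb{Z}^2}$ (product topology, $\Sigma$ discrete) that is invariant under all $\sigma_v$; it is minimal if it is non-empty and contains no proper non-empty subshift. A configuration $x\in\Sigma^{\mathbb{Z}^2}$ is horizontally periodic if $\sigma_{(n,0)}(x)=x$ for some non-zero integer $n$. A Turing degree is the Turing degree of an infinite binary sequence $s\in\{0,1\}^{\mathbb{N}}$; the degree $\deg_T x$ of a configuration $x$ is that of the function $\mathbb{N}\to\mathbb{N}$ obtained by listing the cells of $\mathbb{Z}^2$ through a fixed computable bijection $\mathbb{N}\to\mathbb{Z}^2$ and numbering the letters of $\Sigma$ (the numbering does not matter). **Theorem.** Let $A\subseteq\Sigma^{\mathbb{Z}^2}$ be a minimal two-dimensional subshift. Then no point of $A$ is horizontally periodic if and only if some point of $A$ is not horizontally periodic. If this is the case, then for every point $x\in A$ and every Turing degree $d$ with $\deg_T x\leq d$ there exists a point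 $y\in A$ with $\deg_T y=d$. -/

import Mathlib

/-- A two-dimensional subshift is *minimal* if it is non-empty and
contains no proper non-empty subshift. -/
def IsMinimalSubshift {S : Type*} [TopologicalSpace S] (A : SymbolicDynamics.FullShift.Subshift S (ℤ × ℤ)) : Prop :=
  A.carrier.Nonempty ∧
    ∀ B : SymbolicDynamics.FullShift.Subshift S (ℤ × ℤ), B.carrier.Nonempty → B.carrier ⊆ A.carrier →
      B.carrier = A.carrier

/-- A two-dimensional configuration is *horizontally periodic* if it is invariant under the shift
by some non-zero horizontal vector `(n, 0)`. -/
def HorizontallyPeriodic {S : Type*} (x : ℤ × ℤ → S) : Prop :=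
  ∃ n : ℤ, n ≠ 0 ∧ SymbolicDynamics.FullShift.shift ((n, 0) : ℤ × ℤ) x = x

/-- The Turing degree of a total function `f : ℕ → ℕ`. -/
noncomputable def funDegree (f : ℕ → ℕ) : TuringDegree :=
  toAntisymmetrization TuringReducible (f : ℕ →. ℕ)

/-- The Turing degree of an infinite binary sequence. -/
noncomputable def seqDegree (s : ℕ → Bool) : TuringDegree :=
  funDegree fun n => (s n).toNat

/-- A configuration read as a sequence of natural numbers: the cells are listed through the
standard computable bijection `ℕ ≃ ℤ × ℤ`, and the letters are replaced by numbers through `c`. -/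
def configCode {S : Type*} (c : S → ℕ) (x : ℤ × ℤ → S) : ℕ → ℕ :=
  fun n => c (x (Denumerable.ofNat (ℤ × ℤ) n))

/-- The Turing degree of a two-dimensional configuration over a finite alphabet, the letters being
numbered from `0` to `Nat.card S - 1`. By `configDegree_eq` below the numbering is irrelevant. -/
noncomputable def configDegree {S : Type*} [Finite S] (x : ℤ × ℤ → S) : TuringDegree :=
  funDegree (configCode (fun a => (Finite.equivFin S a : ℕ)) x)

theorem funDegree_le_iff (f g : ℕ → ℕ) :
    funDegree f ≤ funDegree g ↔
      TuringReducible (f : ℕ →. ℕ) (g : ℕ →. ℕ) :=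
  Iff.rfl

theorem configCode_degree_le {S : Type*} [Finite S] (c c' : S → ℕ) (hc : Function.Injective c)
    (x : ℤ × ℤ → S) : funDegree (configCode c' x) ≤ funDegree (configCode c x) := by
  classical
  rw [funDegree_le_iff]
  cases nonempty_fintype S
  obtain ⟨N, hN⟩ : ∃ N, ∀ a, c a < N :=
    ⟨(Finset.univ.sup c) + 1, fun a => Nat.lt_succ_of_le (Finset.le_sup (Finset.mem_univ a))⟩
  let h : ℕ → ℕ := fun n => if hn : ∃ a, c a = n then c' hn.choose else 0
  have hh : ∀ a, h (c a) = c' a := fun a => by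
    have hn : ∃ b, c b = c a := ⟨a, rfl⟩
    simp only [h, dif_pos hn]
    rw [hc hn.choose_spec]
  let l : List ℕ := (List.range N).map h
  have hl : Nat.Primrec fun n => l.getD n 0 :=
    Primrec.nat_iff.1 ((Primrec.list_getD 0).comp (Primrec.const l) Primrec.id)
  have hlc : ∀ a, l.getD (c a) 0 = c' a := fun a => by
    simp [l, List.getD, hN a, hh a]
  have key := Nat.RecursiveIn.comp (O := {((configCode c x : ℕ → ℕ) : ℕ →. ℕ)})
    hl.recursiveIn (Nat.RecursiveIn.oracle _ (Set.mem_singleton _))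
  refine RecursiveIn.iff_nat.2 (key.of_eq fun n => by
    simp only [configCode, Part.bind_eq_bind, Part.bind_some, PFun.coe_val]
    rw [hlc]
    rfl)

/-- The degree of a configuration does not depend on how the letters are numbered. -/
theorem configDegree_eq {S : Type*} [Finite S] (c : S → ℕ) (hc : Function.Injective c)
    (x : ℤ × ℤ → S) : configDegree x = funDegree (configCode c x) :=
  le_antisymm (configCode_degree_le _ _ hc x)
    (configCode_degree_le _ _ (fun _ _ h => (Finite.equivFin S).injective (Fin.ext h)) x)

/-! Let `q` be a pattern on the first cells of the plane. If no point is horizontally periodic,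
every point `z` of `A` showing `q` has a translate that also shows `q` but differs from `z`
(`IsMinimalSubshift.exists_shift_mem_cylinder_ne`); at the first cell where they differ, the number
of the letter goes up or down. If `z` is lexicographically least among the points showing `q`, every
such translate goes up; if `z` is greatest, every one goes down. Hence the shortest prefix of `z` in
which such a return of `q` is visible can be given either sign
(`IsMinimalSubshift.exists_isNextPrefix`).

Iterating this writes a binary sequence `s` into a growing chain of patterns, the `n`-th sign being
`s n`. By minimality all these patterns occur in `x`, so a search through translates of `x` finds
them, and the limit `y` is computable from `s` once `x` is. Conversely, the next prefix is unique
among the prefixes of `y` (`IsNextPrefix.unique`), so `y` computes the chain and its signs.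

The equivalence holds because the points of `A` with a given horizontal period form a subshift. -/

/-! ### Closure properties of relative computability. -/

open Encodable in
theorem RecursiveIn.comp {α β σ : Type*} [Primcodable α] [Primcodable β] [Primcodable σ]
    {O : Set (ℕ →. ℕ)} {f : β →. σ} {g : α → β} (hf : RecursiveIn O f) (hg : ComputableIn O g) :
    RecursiveIn O fun a => f (g a) :=
  (Nat.RecursiveIn.comp hf hg).of_eq fun n => by
    simp only [Part.map_some, Part.bind_eq_bind]
    rcases e : decode (α := α) n with - | a <;> simp [encodek]

theorem ComputableIn.comp {α β σ : Type*} [Primcodable α] [Primcodable β] [Primcodable σ]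
    {O : Set (ℕ →. ℕ)} {f : β → σ} {g : α → β} (hf : ComputableIn O f) (hg : ComputableIn O g) :
    ComputableIn O fun a => f (g a) :=
  RecursiveIn.comp (f := fun b => Part.some (f b)) hf hg

open Encodable in
theorem ComputableIn.pair {α β γ : Type*} [Primcodable α] [Primcodable β] [Primcodable γ]
    {O : Set (ℕ →. ℕ)} {f : α → β} {g : α → γ} (hf : ComputableIn O f) (hg : ComputableIn O g) :
    ComputableIn O fun a => (f a, g a) :=
  (Nat.RecursiveIn.pair hf hg).of_eq fun n => by
    cases decode (α := α) n <;> simp [Seq.seq]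

open Encodable in
theorem RecursiveIn.bind {α β σ : Type*} [Primcodable α] [Primcodable β] [Primcodable σ]
    {O : Set (ℕ →. ℕ)} {f : α →. β} {g : β →. σ} (hf : RecursiveIn O f) (hg : RecursiveIn O g) :
    RecursiveIn O fun a => (f a).bind g :=
  (Nat.RecursiveIn.comp hg hf).of_eq fun n => by
    rcases e : decode (α := α) n with - | a
    · simp
    · simp only [Part.coe_some, Part.bind_some, Part.bind_eq_bind, Part.bind_map, encodek]
      exact (Part.map_bind ..).symm

open Encodable in
/-- Primitive recursion along `ℕ` of a partial step function with a parameter. -/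
theorem RecursiveIn.nat_rec {α σ : Type*} [Primcodable α] [Primcodable σ]
    {O : Set (ℕ →. ℕ)} {g : α →. σ} {h : α × (ℕ × σ) →. σ}
    (hg : RecursiveIn O g) (hh : RecursiveIn O h) :
    RecursiveIn O fun p : α × ℕ =>
      (p.2.rec (g p.1) fun y IH => IH.bind fun i => h (p.1, (y, i)) : Part σ) := by
  have h1 := Nat.RecursiveIn.prec hg hh
  have h2 : ComputableIn O (id : α × ℕ → α × ℕ) := ComputableIn.id
  refine (Nat.RecursiveIn.comp h1 h2).of_eq fun n => ?_
  rcases e : decode (α := α × ℕ) n with - | ⟨a, k⟩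
  · simp
  · simp only [Part.coe_some, Part.bind_some, Part.map_some, id, Part.bind_eq_bind,
      encode_prod_val, Nat.unpair_pair]
    simp only [encode_nat]
    clear e
    induction k with
    | zero => simp [encodek]
    | succ k ih =>
      simp only [ih, Part.bind_map, Part.map_bind]
      simp [encodek]

theorem ComputableIn.nat_rec {α σ : Type*} [Primcodable α] [Primcodable σ]
    {O : Set (ℕ →. ℕ)} {g : α → σ} {h : α × (ℕ × σ) → σ}
    (hg : ComputableIn O g) (hh : ComputableIn O h) :
    ComputableIn O fun p : α × ℕ => (p.2.rec (g p.1) fun y i => h (p.1, (y, i)) : σ) := by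
  refine (RecursiveIn.nat_rec hg hh).of_eq fun ⟨a, k⟩ => ?_
  induction k with
  | zero => rfl
  | succ k ih => simp_all

open Encodable in
theorem RecursiveIn.rfind {α : Type*} [Primcodable α] {O : Set (ℕ →. ℕ)} {p : α × ℕ → Bool}
    (hp : ComputableIn O p) :
    RecursiveIn O fun a => Nat.rfind fun n => Part.some (p (a, n)) := by
  -- Minimization on `ℕ` looks for a zero, so `true` is coded by `0`.
  have h0 : Primrec fun b : Bool => cond b 0 1 :=
    Primrec.cond .id (.const 0) (.const 1)
  have h1 := Nat.RecursiveIn.rfind ((h0.computableIn (O := O)).comp hp)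
  have h2 : ComputableIn O (id : α → α) := ComputableIn.id
  refine (Nat.RecursiveIn.comp h1 h2).of_eq fun n => ?_
  rcases e : decode (α := α) n with - | a
  · simp
  · simp only [Part.coe_some, Part.bind_some, Part.map_some, id, Part.bind_eq_bind]
    have : (fun n => Part.some (p (a, n))) = fun k => Part.map (fun m => decide (m = 0))
        (((decode (α := α × ℕ) (Nat.pair (encode a) k) : Option (α × ℕ)) : Part (α × ℕ)).bind
          fun a => Part.some (encode (cond (p a) 0 1))) := by
      funext k
      have : decode (α := α × ℕ) (Nat.pair (encode a) k) = some (a, k) := by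
        simp [decode_prod_val, encodek]
      rw [this]
      cases h : p (a, k) <;> simp [h]
    rw [this]
    simp [Part.map_id', Part.map_eq_map]

theorem Nat.rfind_some_eq_find {p : ℕ → Bool} (h : ∃ n, p n = true) :
    (Nat.rfind fun n => Part.some (p n)) = Part.some (Nat.find h) := by
  refine Part.eq_some_iff.2 (Nat.mem_rfind.2 ?_)
  refine ⟨by simpa using (Nat.find_spec h).symm, fun {m} hm => ?_⟩
  exact Part.mem_some_iff.2 (Bool.eq_false_of_not_eq_true (Nat.find_min h hm)).symm

/-- A sequence whose next term is found by an unbounded search along a computable family is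
computable. The search only has to terminate along the sequence itself. -/
theorem ComputableIn.of_find {σ : Type*} [Primcodable σ] {O : Set (ℕ →. ℕ)} {g e : ℕ → σ}
    {P : (ℕ × σ) × ℕ → Bool} (hP : ComputableIn O P) (he : ComputableIn O e)
    (hex : ∀ n, ∃ t, P ((n, g n), t) = true) (hg : ∀ n, g (n + 1) = e (Nat.find (hex n))) :
    ComputableIn O g := by
  -- The search may diverge on pairs off the sequence, so the recursion step is only partial.
  have h1 : RecursiveIn O fun p : ℕ × σ =>
      (Nat.rfind fun t => Part.some (P (p, t))).bind fun t => Part.some (e t) :=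
    (RecursiveIn.rfind hP).bind he
  have h2 : ComputableIn O fun p : ℕ × (ℕ × σ) => p.2 := Primrec.snd.computableIn
  -- The recursion needs no parameter; a dummy one is set to `0` in `h4`.
  have h3 := RecursiveIn.nat_rec (α := ℕ) (ComputableIn.const (O := O) (g 0)) (h1.comp h2)
  have h4 : ComputableIn O fun n : ℕ => ((0 : ℕ), n) :=
    ((Primrec.const 0).pair Primrec.id).computableIn
  refine (h3.comp h4).of_eq fun n => ?_
  induction n with
  | zero => rfl
  | succ n ih =>
    simp only at ih ⊢
    rw [ih, Part.bind_some, Nat.rfind_some_eq_find (hex n), Part.bind_some, hg n]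

theorem List.range_map_eq_rec {σ : Type*} (f : ℕ → σ) (n : ℕ) :
    (List.range n).map f = n.rec [] fun y i => i ++ [f y] := by
  induction n with
  | zero => rfl
  | succ n ih => simp [List.range_succ, ih]

theorem ComputableIn.range_map {α σ : Type*} [Primcodable α] [Primcodable σ]
    {O : Set (ℕ →. ℕ)} {f : α × ℕ → σ} (hf : ComputableIn O f) :
    ComputableIn O fun p : α × ℕ => (List.range p.2).map fun i => f (p.1, i) := by
  have h1 : ComputableIn O fun p : α × (ℕ × List σ) => p.2.2 ++ [f (p.1, p.2.1)] := by
    have h2 : ComputableIn O fun p : α × (ℕ × List σ) => f (p.1, p.2.1) :=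
      hf.comp (Primrec.fst.pair (Primrec.fst.comp Primrec.snd)).computableIn
    have h3 : ComputableIn O fun p : α × (ℕ × List σ) => p.2.2 :=
      (Primrec.snd.comp Primrec.snd).computableIn
    have h4 : ComputableIn O fun p : List σ × σ => p.1 ++ [p.2] :=
      Primrec.list_concat.computableIn
    exact h4.comp (h3.pair h2)
  refine (ComputableIn.nat_rec (ComputableIn.const (O := O) ([] : List σ)) h1).of_eq fun p => ?_
  exact congrArg Part.some (List.range_map_eq_rec (fun i => f (p.1, i)) p.2).symm

/-! ### Translation of cells is primitive recursive. -/

theorem Int.encode_eq_ite (z : ℤ) :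
    Encodable.encode z = if 0 ≤ z then 2 * z.toNat else 2 * (-z - 1).toNat + 1 := by
  cases z with
  | ofNat n => 
    change 2 * n = _
    simp
  | negSucc n =>
    change 2 * n + 1 = _
    rw [if_neg (by simp)]
    congr 2
    omega

theorem Int.ofNat_eq_ite (n : ℕ) :
    Denumerable.ofNat ℤ n = if n % 2 = 0 then ((n / 2 : ℕ) : ℤ) else -((n / 2 : ℕ) : ℤ) - 1 := by
  rw [← Encodable.encode_inj, Denumerable.encode_ofNat, Int.encode_eq_ite]
  split_ifs <;> omega

theorem Primrec.int_add_code : Primrec₂ fun a b : ℕ =>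
    Encodable.encode (Denumerable.ofNat ℤ a + Denumerable.ofNat ℤ b) := by
  have half {f : ℕ × ℕ → ℕ} (hf : Primrec f) : Primrec fun p => f p / 2 :=
    Primrec.nat_div.comp hf (.const 2)
  have even {f : ℕ × ℕ → ℕ} (hf : Primrec f) : PrimrecPred fun p => f p % 2 = 0 :=
    Primrec.eq.comp (Primrec.nat_mod.comp hf (.const 2)) (.const 0)
  -- Even codes `2 * n` stand for `n`, odd codes `2 * n + 1` for `-n - 1`. Here `f` codes a
  -- non-negative and `g` a negative integer, and the test decides the sign of their sum.
  have mixed {f g : ℕ × ℕ → ℕ} (hf : Primrec f) (hg : Primrec g) : Primrec fun p =>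
      if g p / 2 < f p / 2 then 2 * (f p / 2 - g p / 2 - 1) else 2 * (g p / 2 - f p / 2) + 1 :=
    Primrec.ite (Primrec.nat_lt.comp (half hg) (half hf))
      (Primrec.nat_mul.comp (.const 2) (Primrec.nat_sub.comp
        (Primrec.nat_sub.comp (half hf) (half hg)) (.const 1)))
      (Primrec.nat_add.comp (Primrec.nat_mul.comp (.const 2)
        (Primrec.nat_sub.comp (half hg) (half hf))) (.const 1))
  have key := Primrec.ite (even .fst)
    (Primrec.ite (even .snd) (Primrec.nat_add.comp .fst .snd) (mixed .fst .snd))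
    (Primrec.ite (even .snd) (mixed .snd .fst)
      (Primrec.nat_add.comp (Primrec.nat_add.comp .fst .snd) (.const 1)))
  refine key.of_eq fun ⟨a, b⟩ => ?_
  simp only [Int.encode_eq_ite, Int.ofNat_eq_ite]
  split_ifs <;> omega

/-- The `n`-th cell of the plane in the standard enumeration. -/
abbrev planeCell (n : ℕ) : ℤ × ℤ := Denumerable.ofNat (ℤ × ℤ) n

/-- The index of the cell obtained by translating the `i`-th cell by the `v`-th one. -/
def translateIndex (v i : ℕ) : ℕ := Encodable.encode (planeCell v + planeCell i)

theorem planeCell_translateIndex (v i : ℕ) :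
    planeCell (translateIndex v i) = planeCell v + planeCell i :=
  Denumerable.ofNat_encode _

theorem Primrec.translateIndex : Primrec₂ translateIndex := by
  have l {f : ℕ × ℕ → ℕ} (hf : Primrec f) : Primrec fun p => (f p).unpair.1 :=
    Primrec.fst.comp (Primrec.unpair.comp hf)
  have r {f : ℕ × ℕ → ℕ} (hf : Primrec f) : Primrec fun p => (f p).unpair.2 :=
    Primrec.snd.comp (Primrec.unpair.comp hf)
  refine (Primrec₂.natPair.comp (Primrec.int_add_code.comp (l .fst) (l .snd))
    (Primrec.int_add_code.comp (r .fst) (r .snd))).of_eq fun ⟨v, i⟩ => ?_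
  simp [_root_.translateIndex, planeCell, Encodable.encode_prod_val]

/-! ### Returns of a pattern and their signs. -/

/-- In the list `p` of the letters of a configuration at the first cells, some translation agrees
with the identity up to a cell beyond the `m`-th one, where it changes the letter; the letter
increases if `b` holds and decreases otherwise. -/
def ReturnSign (p : List ℕ) (m : ℕ) (b : Bool) : Prop :=
  ∃ v < p.length, ∃ d < p.length, m ≤ d ∧ (∀ i < d + 1, translateIndex v i < p.length) ∧
    (∀ i < d, p.getD (translateIndex v i) 0 = p.getD i 0) ∧
    ((b = true ∧ p.getD d 0 < p.getD (translateIndex v d) 0) ∨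
      (b = false ∧ p.getD (translateIndex v d) 0 < p.getD d 0))

/-- The list `p` is the shortest extension of `q` with a return of `q` that can be told from `q`. -/
def IsNextPrefix (q p : List ℕ) : Prop :=
  p.take q.length = q ∧ (∃ b, ReturnSign p q.length b) ∧
    ∀ l < p.length, ∀ b, ¬ ReturnSign (p.take l) q.length b

theorem PrimrecRel.exists_lt_comp {α : Type*} [Primcodable α] {R : ℕ → α → Prop} {f : α → ℕ}
    (hR : PrimrecRel R) (hf : Primrec f) : PrimrecPred fun a => ∃ x < f a, R x a :=
  (hR.exists_mem_list.comp (Primrec.list_range.comp hf) .id).of_eq fun a => by simp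

theorem PrimrecRel.forall_lt_comp {α : Type*} [Primcodable α] {R : ℕ → α → Prop} {f : α → ℕ}
    (hR : PrimrecRel R) (hf : Primrec f) : PrimrecPred fun a => ∀ x < f a, R x a :=
  (hR.forall_mem_list.comp (Primrec.list_range.comp hf) .id).of_eq fun a => by simp

/-- Every quantifier is bounded in terms of the list. This is why `ReturnSign` requires even the
index `v` of the translation to be below the length. -/
theorem PrimrecPred.returnSign :
    PrimrecPred fun a : (List ℕ × ℕ) × Bool => ReturnSign a.1.1 a.1.2 a.2 := by
  have get {α : Type} [Primcodable α] {f : α → List ℕ} {n : α → ℕ} (hf : Primrec f)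
      (hn : Primrec n) : Primrec fun a => (f a).getD (n a) 0 :=
    (Primrec.list_getD 0).comp hf hn
  have tr {α : Type} [Primcodable α] {v i : α → ℕ} (hv : Primrec v) (hi : Primrec i) :
      Primrec fun a => translateIndex (v a) (i a) := Primrec.translateIndex.comp hv hi
  have hp1 : Primrec fun x : ℕ × (ℕ × ((List ℕ × ℕ) × Bool)) => x.2.2.1.1 :=
    Primrec.fst.comp (Primrec.fst.comp (Primrec.snd.comp Primrec.snd))
  have hv1 : Primrec fun x : ℕ × (ℕ × ((List ℕ × ℕ) × Bool)) => x.2.1 :=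
    Primrec.fst.comp Primrec.snd
  have hb1 : Primrec fun x : ℕ × (ℕ × ((List ℕ × ℕ) × Bool)) => x.2.2.2 :=
    Primrec.snd.comp (Primrec.snd.comp Primrec.snd)
  have hm1 : Primrec fun x : ℕ × (ℕ × ((List ℕ × ℕ) × Bool)) => x.2.2.1.2 :=
    Primrec.snd.comp (Primrec.fst.comp (Primrec.snd.comp Primrec.snd))
  have hd1 : Primrec fun x : ℕ × (ℕ × ((List ℕ × ℕ) × Bool)) => x.1 := Primrec.fst
  have hin : PrimrecRel fun (i : ℕ) (x : ℕ × (ℕ × ((List ℕ × ℕ) × Bool))) =>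
      translateIndex x.2.1 i < x.2.2.1.1.length :=
    Primrec.nat_lt.comp (tr (hv1.comp .snd) .fst) (Primrec.list_length.comp (hp1.comp .snd))
  have heq : PrimrecRel fun (i : ℕ) (x : ℕ × (ℕ × ((List ℕ × ℕ) × Bool))) =>
      x.2.2.1.1.getD (translateIndex x.2.1 i) 0 = x.2.2.1.1.getD i 0 :=
    Primrec.eq.comp (get (hp1.comp .snd) (tr (hv1.comp .snd) .fst)) (get (hp1.comp .snd) .fst)
  have hd : PrimrecRel fun (d : ℕ) (x : ℕ × ((List ℕ × ℕ) × Bool)) =>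
      x.2.1.2 ≤ d ∧ (∀ i < d + 1, translateIndex x.1 i < x.2.1.1.length) ∧
      (∀ i < d, x.2.1.1.getD (translateIndex x.1 i) 0 = x.2.1.1.getD i 0) ∧
      ((x.2.2 = true ∧ x.2.1.1.getD d 0 < x.2.1.1.getD (translateIndex x.1 d) 0) ∨
        (x.2.2 = false ∧ x.2.1.1.getD (translateIndex x.1 d) 0 < x.2.1.1.getD d 0)) :=
    (Primrec.nat_le.comp hm1 hd1).and <|
      (PrimrecRel.forall_lt_comp hin (Primrec.succ.comp hd1)).and <|
      (PrimrecRel.forall_lt_comp heq hd1).and <|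
      ((Primrec.eq.comp hb1 (.const true)).and
        (Primrec.nat_lt.comp (get hp1 hd1) (get hp1 (tr hv1 hd1)))).or
      ((Primrec.eq.comp hb1 (.const false)).and
        (Primrec.nat_lt.comp (get hp1 (tr hv1 hd1)) (get hp1 hd1)))
  have hv : PrimrecRel fun (v : ℕ) (a : (List ℕ × ℕ) × Bool) => ∃ d < a.1.1.length,
      a.1.2 ≤ d ∧ (∀ i < d + 1, translateIndex v i < a.1.1.length) ∧
      (∀ i < d, a.1.1.getD (translateIndex v i) 0 = a.1.1.getD i 0) ∧
      ((a.2 = true ∧ a.1.1.getD d 0 < a.1.1.getD (translateIndex v d) 0) ∨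
        (a.2 = false ∧ a.1.1.getD (translateIndex v d) 0 < a.1.1.getD d 0)) :=
    PrimrecRel.exists_lt_comp hd
      (Primrec.list_length.comp (Primrec.fst.comp (Primrec.fst.comp Primrec.snd)))
  exact PrimrecRel.exists_lt_comp hv (Primrec.list_length.comp (Primrec.fst.comp Primrec.fst))

theorem PrimrecRel.exists_returnSign :
    PrimrecRel fun (p : List ℕ) (m : ℕ) => ∃ b, ReturnSign p m b :=
  ((PrimrecPred.returnSign.comp (Primrec.id.pair (.const true))).or
    (PrimrecPred.returnSign.comp (Primrec.id.pair (.const false)))).of_eq fun a => by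
      simp [or_comm]

theorem PrimrecRel.isNextPrefix : PrimrecRel IsNextPrefix := by
  have hlen : Primrec fun a : List ℕ × List ℕ => a.1.length := Primrec.list_length.comp .fst
  have hsmall : PrimrecRel fun (l : ℕ) (a : List ℕ × List ℕ) =>
      ¬ ∃ b, ReturnSign (a.2.take l) a.1.length b :=
    (PrimrecRel.exists_returnSign.comp
      (Primrec.list_take.comp .fst (Primrec.snd.comp .snd)) (hlen.comp .snd)).not
  refine ((Primrec.eq.comp (Primrec.list_take.comp hlen .snd) .fst).and
    ((PrimrecRel.exists_returnSign.comp .snd hlen).and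
      (PrimrecRel.forall_lt_comp hsmall (Primrec.list_length.comp .snd)))).of_eq fun a => ?_
  simp [IsNextPrefix]

theorem ReturnSign.lt_length {p : List ℕ} {m : ℕ} {b : Bool} (h : ReturnSign p m b) :
    m < p.length := by
  obtain ⟨v, -, d, hd, hmd, -⟩ := h
  omega

theorem IsNextPrefix.length_lt {q p : List ℕ} (h : IsNextPrefix q p) : q.length < p.length := by
  obtain ⟨-, ⟨b, hb⟩, -⟩ := h
  exact hb.lt_length

theorem IsNextPrefix.isPrefix {q p : List ℕ} (h : IsNextPrefix q p) : q <+: p := by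
  have := List.take_prefix q.length p
  rwa [h.1] at this

/-- Among the prefixes of a sequence there is at most one next prefix. -/
theorem IsNextPrefix.unique {q p p' : List ℕ} (h : IsNextPrefix q p) (h' : IsNextPrefix q p')
    (hpp' : p <+: p' ∨ p' <+: p) : p = p' := by
  wlog hw : p <+: p' generalizing p p'
  · exact (this h' h hpp'.symm (hpp'.resolve_left hw)).symm
  rcases hw.length_le.lt_or_eq with hlt | heq
  -- If `p` were strictly shorter, it would be a truncation of `p'` already showing a return.
  · obtain ⟨b, hb⟩ := h.2.1
    rw [List.prefix_iff_eq_take.1 hw] at hb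
    exact absurd hb (h'.2.2 _ hlt b)
  · exact hw.eq_of_length heq

/-- The sign of the first distinguishable return. -/
noncomputable def returnBit (a : List ℕ × List ℕ) : Bool :=
  @decide (ReturnSign a.2 a.1.length true) (Classical.dec _)

theorem Primrec.returnBit : Primrec returnBit := by
  classical
  have h := PrimrecPred.returnSign.comp ((Primrec.snd.pair (Primrec.list_length.comp
    Primrec.fst)).pair (Primrec.const true) : Primrec fun a : List ℕ × List ℕ => ((a.2, a.1.length), true))
  exact h.decide.of_eq fun a => by simp only [_root_.returnBit]

/-! ### Prefixes of sequences. -/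

/-- The first `l` terms of a sequence. -/
def seqPrefix (f : ℕ → ℕ) (l : ℕ) : List ℕ := (List.range l).map f

@[simp]
theorem length_seqPrefix (f : ℕ → ℕ) (l : ℕ) : (seqPrefix f l).length = l := by simp [seqPrefix]

theorem take_seqPrefix (f : ℕ → ℕ) {l k : ℕ} (h : l ≤ k) :
    (seqPrefix f k).take l = seqPrefix f l := by
  simp [seqPrefix, ← List.map_take, List.take_range, h]

theorem getD_seqPrefix (f : ℕ → ℕ) {l i : ℕ} (h : i < l) : (seqPrefix f l).getD i 0 = f i := by
  simp [seqPrefix, List.getD, h]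

theorem seqPrefix_congr {f g : ℕ → ℕ} {l : ℕ} : seqPrefix f l = seqPrefix g l ↔ ∀ i < l, f i = g i := by
  simp [seqPrefix]

theorem seqPrefix_isPrefix (f : ℕ → ℕ) {l k : ℕ} (h : l ≤ k) : seqPrefix f l <+: seqPrefix f k := by
  rw [← take_seqPrefix f h]
  exact List.take_prefix _ _

theorem returnSign_seqPrefix {f : ℕ → ℕ} {l m : ℕ} {b : Bool} : ReturnSign (seqPrefix f l) m b ↔
    ∃ v < l, ∃ d < l, m ≤ d ∧ (∀ i < d + 1, translateIndex v i < l) ∧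
    (∀ i < d, f (translateIndex v i) = f i) ∧
    ((b = true ∧ f d < f (translateIndex v d)) ∨ (b = false ∧ f (translateIndex v d) < f d)) := by
  unfold ReturnSign
  simp only [length_seqPrefix]
  refine exists_congr fun v => and_congr_right fun hv => exists_congr fun d => and_congr_right
    fun hd => and_congr_right fun hm => and_congr_right fun hi => ?_
  rw [getD_seqPrefix f hd, getD_seqPrefix f (hi d (by omega))]
  refine and_congr_left fun _ => forall₂_congr fun i hid => ?_
  rw [getD_seqPrefix f (hid.trans hd), getD_seqPrefix f (hi i (by omega))]

/-- If some translation agreeing with `f` on the first `m` places differs from `f`, then a prefix of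
`f` is the next prefix. -/
theorem exists_isNextPrefix {f : ℕ → ℕ} {m v j : ℕ} (hv : ∀ i < m, f (translateIndex v i) = f i)
    (hj : f (translateIndex v j) ≠ f j) : ∃ l, IsNextPrefix (seqPrefix f m) (seqPrefix f l) := by
  classical
  have hex : ∃ l, ∃ b, ReturnSign (seqPrefix f l) m b := by
    have hd : ∃ d, f (translateIndex v d) ≠ f d := ⟨j, hj⟩
    have hspec := Nat.find_spec hd
    have hmin : ∀ i < Nat.find hd, f (translateIndex v i) = f i := fun i hi => by
      simpa using Nat.find_min hd hi
    set d := Nat.find hd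
    obtain ⟨N, hN⟩ : ∃ N, ∀ i < d + 1, translateIndex v i < N :=
      ⟨(Finset.range (d + 1)).sup (translateIndex v) + 1, fun i hi =>
        Nat.lt_succ_of_le (Finset.le_sup (Finset.mem_range.2 hi))⟩
    -- Long enough to contain `v`, the first difference `d`, and all translated indices up to it.
    refine ⟨v + d + N + 1, ?_⟩
    have hmd : m ≤ d := not_lt.1 fun h => hspec (hv d h)
    rcases hspec.lt_or_gt with h | h
    · exact ⟨false, returnSign_seqPrefix.2 ⟨v, by omega, d, by omega, hmd,
        fun i hi => (hN i hi).trans (by omega), hmin, .inr ⟨rfl, h⟩⟩⟩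
    · exact ⟨true, returnSign_seqPrefix.2 ⟨v, by omega, d, by omega, hmd,
        fun i hi => (hN i hi).trans (by omega), hmin, .inl ⟨rfl, h⟩⟩⟩
  have hspec := Nat.find_spec hex
  refine ⟨Nat.find hex, ?_, by simpa using hspec, fun l hl b hb => ?_⟩
  · obtain ⟨b, hb⟩ := hspec
    have := hb.lt_length
    rw [length_seqPrefix] at this ⊢
    exact take_seqPrefix f this.le
  · rw [length_seqPrefix] at hl hb
    rw [take_seqPrefix f hl.le] at hb
    exact Nat.find_min hex hl ⟨b, hb⟩

/-! ### Minimality, recurrence and periods. -/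

section Dynamics

open SymbolicDynamics.FullShift

variable {S : Type*} [TopologicalSpace S]

/-- Every orbit of a minimal subshift visits every cylinder of the subshift. -/
theorem IsMinimalSubshift.exists_shift_mem_cylinder [DiscreteTopology S]
    {A : Subshift S (ℤ × ℤ)} (hA : IsMinimalSubshift A) {x z : ℤ × ℤ → S} (hx : x ∈ A.carrier)
    (hz : z ∈ A.carrier) (U : Finset (ℤ × ℤ)) : ∃ u, shift u x ∈ cylinder U z := by
  -- The orbit closure of `x` is a non-empty subshift inside `A`, hence all of `A`.
  let B : Subshift S (ℤ × ℤ) :=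
    { carrier := closure (Set.range fun u => shift u x)
      isClosed := isClosed_closure
      mapsTo := fun g => by
        refine Set.MapsTo.closure ?_ (continuous_shift g)
        rintro _ ⟨u, rfl⟩
        exact ⟨u + g, shift_add u g x⟩ }
  have hB : B.carrier = A.carrier := hA.2 B ⟨_, subset_closure ⟨0, rfl⟩⟩
    (closure_minimal (by rintro _ ⟨u, rfl⟩; exact A.mapsTo u hx) A.isClosed)
  have hzB : z ∈ closure (Set.range fun u => shift u x) := by
    change z ∈ B.carrier
    rwa [hB]
  obtain ⟨_, hy, u, rfl⟩ := mem_closure_iff.1 hzB _ (isOpen_cylinder U z) fun _ _ => rfl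
  exact ⟨u, hy⟩

/-- In a minimal subshift, one horizontally periodic point makes all points periodic. -/
theorem IsMinimalSubshift.horizontallyPeriodic_of_exists [T2Space S]
    {A : Subshift S (ℤ × ℤ)} (hA : IsMinimalSubshift A) {x z : ℤ × ℤ → S} (hx : x ∈ A.carrier)
    (hz : z ∈ A.carrier) (hp : HorizontallyPeriodic x) : HorizontallyPeriodic z := by
  obtain ⟨n, hn, hxn⟩ := hp
  -- The points of period `(n, 0)` are shift-invariant because `ℤ × ℤ` is commutative.
  let B : Subshift S (ℤ × ℤ) :=
    { carrier := A.carrier ∩ {y | shift ((n, 0) : ℤ × ℤ) y = y}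
      isClosed := A.isClosed.inter (isClosed_eq (continuous_shift _) continuous_id)
      mapsTo := fun g y hy => ⟨A.mapsTo g hy.1, by
        change shift _ (shift g y) = shift g y
        rw [← shift_add, add_comm, shift_add, show shift ((n, 0) : ℤ × ℤ) y = y from hy.2]⟩ }
  have hB : B.carrier = A.carrier := hA.2 B ⟨x, hx, hxn⟩ Set.inter_subset_left
  rw [← hB] at hz
  exact ⟨n, hn, hz.2⟩

theorem Subshift.isCompact_carrier [Finite S] {G : Type*} [AddMonoid G] (A : Subshift S G) :
    IsCompact A.carrier :=
  A.isClosed.isCompact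

/-- A point of a minimal subshift that is not horizontally periodic has, in each of its cylinders,
a translate different from it. -/
theorem IsMinimalSubshift.exists_shift_mem_cylinder_ne [Finite S] [DiscreteTopology S]
    {A : Subshift S (ℤ × ℤ)} (hA : IsMinimalSubshift A) {z : ℤ × ℤ → S} (hz : z ∈ A.carrier)
    (hp : ¬ HorizontallyPeriodic z) (U : Finset (ℤ × ℤ)) :
    ∃ v, shift v z ∈ cylinder U z ∧ shift v z ≠ z := by
  by_contra! hcon
  -- By compactness, finitely many translations suffice to bring every point of `A` into the
  -- cylinder.
  obtain ⟨F, hF⟩ := (Subshift.isCompact_carrier A).elim_finite_subcover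
    (fun v : ℤ × ℤ => shift v ⁻¹' cylinder U z)
    (fun v => (isOpen_cylinder U z).preimage (continuous_shift v)) fun y hy => by
      obtain ⟨u, hu⟩ := hA.exists_shift_mem_cylinder hy hz U
      exact Set.mem_iUnion.2 ⟨u, hu⟩
  -- Applied to a horizontal translate of `z`, such a translation gives a return of `z`, which by
  -- `hcon` is `z` itself.
  have hcov : ∀ n : ℤ, ∃ v : F, shift ((n, 0) + (v : ℤ × ℤ)) z = z := fun n => by
    obtain ⟨v, hvF, hv⟩ := Set.mem_iUnion₂.1 (hF (A.mapsTo (n, 0) hz))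
    refine ⟨⟨v, hvF⟩, hcon _ ?_⟩
    rw [shift_add]
    exact hv
  choose v hv using hcov
  -- Two distinct horizontal shifts share the same correction in `F`, so their difference is a
  -- horizontal period.
  obtain ⟨a, b, hab, hvab⟩ := Finite.exists_ne_map_eq_of_infinite v
  refine hp ⟨a - b, sub_ne_zero.2 hab, ?_⟩
  have h1 : ((a, 0) + (v a : ℤ × ℤ)) = ((b, 0) + (v b : ℤ × ℤ)) + (a - b, 0) := by
    rw [hvab]
    ext
    · simp only [Prod.fst_add]; ring
    · simp
  have h2 := hv a
  rwa [h1, shift_add, hv b] at h2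

end Dynamics

/-! ### Lexicographically least points. -/

/-- A non-empty compact set of sequences of letters has a point that is lexicographically least for
a given valuation of the letters. -/
theorem IsCompact.exists_lex_min {S I : Type*} [TopologicalSpace S] [DiscreteTopology S]
    {C : Set (I → S)} (hC : IsCompact C) (hne : C.Nonempty) (cell : ℕ → I) (k : S → ℕ) :
    ∃ z ∈ C, ∀ z' ∈ C, ∀ d, (∀ i < d, z' (cell i) = z (cell i)) → k (z (cell d)) ≤ k (z' (cell d)) := by
  -- `D n` keeps the points of `C` that are lexicographically least on the first `n` cells.
  let D : ℕ → Set (I → S) := fun n => n.rec C fun n E =>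
    {z | z ∈ E ∧ ∀ z' ∈ E, k (z (cell n)) ≤ k (z' (cell n))}
  have hsub : ∀ n, D (n + 1) ⊆ D n := fun n z hz => hz.1
  have hDne : ∀ n, (D n).Nonempty := fun n => by
    induction n with
    | zero => exact hne
    | succ n ih =>
      obtain ⟨z, hz, hmin⟩ := exists_minimalFor_of_wellFoundedLT (· ∈ D n)
        (fun z : I → S => k (z (cell n))) ih
      exact ⟨z, hz, fun z' hz' => (le_total _ _).elim id fun h => hmin hz' h⟩
  have hclosed : ∀ n, IsClosed (D n) := fun n => by
    induction n with
    | zero => exact hC.isClosed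
    | succ n ih =>
      obtain ⟨z₀, hz₀⟩ := hDne (n + 1)
      -- Comparison with a single minimizer `z₀` replaces the quantifier over `D n`, which makes
      -- closedness evident.
      have : D (n + 1) = D n ∩ {z | k (z (cell n)) ≤ k (z₀ (cell n))} := by
        ext z
        exact ⟨fun hz => ⟨hz.1, hz.2 z₀ hz₀.1⟩, fun hz => ⟨hz.1, fun z' hz' =>
          (show k (z (cell n)) ≤ _ from hz.2).trans (hz₀.2 z' hz')⟩⟩
      rw [this]
      exact ih.inter (isClosed_le (continuous_of_discreteTopology.comp (continuous_apply _))
        continuous_const)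
  obtain ⟨z, hz⟩ := IsCompact.nonempty_iInter_of_sequence_nonempty_isCompact_isClosed D hsub hDne
    hC hclosed
  rw [Set.mem_iInter] at hz
  refine ⟨z, hz 0, fun z' hz' d hd => (hz (d + 1)).2 z' ?_⟩
  induction d with
  | zero => exact hz'
  | succ d ih =>
    refine ⟨ih fun i hi => hd i (by omega), fun w hw => ?_⟩
    rw [hd d (by omega)]
    exact (hz (d + 1)).2 w hw

open SymbolicDynamics.FullShift in
theorem configCode_shift {S : Type*} (c : S → ℕ) (x : ℤ × ℤ → S) (v i : ℕ) :
    configCode c (shift (planeCell v) x) i = configCode c x (translateIndex v i) := by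
  simp only [configCode, shift_apply]
  exact congrArg (fun u => c (x u)) (planeCell_translateIndex v i).symm

theorem configCode_injective {S : Type*} {c : S → ℕ} (hc : Function.Injective c) :
    Function.Injective (configCode c) := fun x y h => by
  funext u
  have := congrFun h (Encodable.encode u)
  simp only [configCode, Denumerable.ofNat_encode] at this
  exact hc this

/-! ### Prescribing the sign of the next return. -/

section Coding

open SymbolicDynamics.FullShift

variable {S : Type*} [Finite S] [TopologicalSpace S] [DiscreteTopology S]
  {A : Subshift S (ℤ × ℤ)} {c : S → ℕ}

omit [Finite S] [TopologicalSpace S] [DiscreteTopology S] in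
theorem mem_cylinder_planeCell {x z : ℤ × ℤ → S} {m : ℕ} (hc : Function.Injective c) :
    x ∈ cylinder ((Finset.range m).image planeCell) z ↔
      seqPrefix (configCode c x) m = seqPrefix (configCode c z) m := by
  simp only [mem_cylinder, Finset.forall_mem_image, Finset.mem_range, seqPrefix_congr, configCode,
    hc.eq_iff]

/-- Every pattern of an aperiodic minimal subshift has a next prefix with any prescribed sign. -/
theorem IsMinimalSubshift.exists_isNextPrefix (hA : IsMinimalSubshift A)
    (hp : ∀ z ∈ A.carrier, ¬ HorizontallyPeriodic z) (hc : Function.Injective c)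
    {x : ℤ × ℤ → S} (hx : x ∈ A.carrier) (m : ℕ) (b : Bool) :
    ∃ z ∈ A.carrier, ∃ l, IsNextPrefix (seqPrefix (configCode c x) m)
      (seqPrefix (configCode c z) l) ∧ ¬ ReturnSign (seqPrefix (configCode c z) l) m (!b) := by
  obtain ⟨N, hN⟩ : ∃ N, ∀ a, c a < N := by
    cases nonempty_fintype S
    exact ⟨(Finset.univ.sup c) + 1, fun a => Nat.lt_succ_of_le (Finset.le_sup (Finset.mem_univ a))⟩
  -- Since `N` bounds the letter numbers, `N - c a` reverses their order: `z` is the least point of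
  -- the cylinder for `b = true` and the greatest for `b = false`.
  obtain ⟨z, ⟨hzA, hzx⟩, hmin⟩ := ((Subshift.isCompact_carrier A).inter_right
    (isClosed_cylinder ((Finset.range m).image planeCell) x)).exists_lex_min
    ⟨x, hx, fun _ _ => rfl⟩ planeCell fun a => cond b (c a) (N - c a)
  have hpre := (mem_cylinder_planeCell hc).1 hzx
  obtain ⟨v, hv, hvne⟩ := hA.exists_shift_mem_cylinder_ne hzA (hp z hzA)
    ((Finset.range m).image planeCell)
  obtain ⟨v, rfl⟩ : ∃ k, planeCell k = v := ⟨_, Denumerable.ofNat_encode v⟩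
  obtain ⟨j, hj⟩ := Function.ne_iff.1 ((configCode_injective hc).ne hvne)
  rw [configCode_shift] at hj
  rw [mem_cylinder_planeCell hc, seqPrefix_congr] at hv
  simp only [configCode_shift] at hv
  obtain ⟨l, hl⟩ := _root_.exists_isNextPrefix hv hj
  refine ⟨z, hzA, l, hpre ▸ hl, fun hr => ?_⟩
  obtain ⟨w, -, d, -, hmd, -, heq, hs⟩ := returnSign_seqPrefix.1 hr
  -- As `m ≤ d`, the translate still shows the pattern of `x`, so it competes with `z` in `hmin`,
  -- and a sign `!b` would beat `z`.
  have hw : shift (planeCell w) z ∈ cylinder ((Finset.range m).image planeCell) x := by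
    rw [mem_cylinder_planeCell hc, ← hpre, seqPrefix_congr]
    intro i hi
    rw [configCode_shift]
    exact heq i (by omega)
  have hle := hmin _ ⟨A.mapsTo _ hzA, hw⟩ d fun i hi => hc <| by
    have := heq i hi
    rwa [← configCode_shift] at this
  rw [← configCode_shift] at hs
  change (_ ∧ c (z (planeCell d)) < c (shift (planeCell w) z (planeCell d))) ∨
    (_ ∧ c (shift (planeCell w) z (planeCell d)) < c (z (planeCell d))) at hs
  have h1 := hN (z (planeCell d))
  have h2 := hN (shift (planeCell w) z (planeCell d))
  cases b <;> simp only [cond_true, cond_false] at hle <;>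
    simp only [Bool.not_true, Bool.not_false, reduceCtorEq, false_and, true_and, or_false,
      false_or] at hs <;> omega

end Coding

/-! ### Limits of chains of prefixes. -/

section Limit

theorem List.IsPrefix.getD_eq {q p : List ℕ} (h : q <+: p) {i : ℕ} (hi : i < q.length) :
    q.getD i 0 = p.getD i 0 := by
  obtain ⟨r, rfl⟩ := h
  exact (List.getD_append _ _ _ _ hi).symm

theorem isPrefix_of_le {g : ℕ → List ℕ} (hg : ∀ n, IsNextPrefix (g n) (g (n + 1))) {m n : ℕ}
    (h : m ≤ n) : g m <+: g n := by
  induction n, h using Nat.le_induction with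
  | base => exact List.prefix_rfl
  | succ n _ ih => exact ih.trans (hg n).isPrefix

/-- Each next prefix is strictly longer, so `g (i + 1)` does have an entry at place `i` and the
default value of `getD` is never read there. -/
theorem le_length {g : ℕ → List ℕ} (hg : ∀ n, IsNextPrefix (g n) (g (n + 1))) (n : ℕ) :
    n ≤ (g n).length := by
  induction n with
  | zero => exact Nat.zero_le _
  | succ n ih => exact ih.trans_lt (hg n).length_lt

/-- The lists of a chain of next prefixes are the prefixes of their limit. -/
theorem eq_seqPrefix_of_chain {g : ℕ → List ℕ} (hg : ∀ n, IsNextPrefix (g n) (g (n + 1)))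
    {f : ℕ → ℕ} (hf : ∀ i, f i = (g (i + 1)).getD i 0) (n : ℕ) :
    g n = seqPrefix f (g n).length := by
  refine List.ext_getElem (by simp) fun i hi _ => ?_
  have h1 : (g n).getD i 0 = (g (i + 1)).getD i 0 :=
    (le_total n (i + 1)).elim (fun h => (isPrefix_of_le hg h).getD_eq hi)
      fun h => ((isPrefix_of_le hg h).getD_eq (le_length hg (i + 1))).symm
  rw [← hf] at h1
  simpa [seqPrefix, List.getD, hi] using h1

end Limit

/-- The test whether `p` is the next prefix of `q`, with sign `b`, on the triple `((q, p), b)`. -/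
noncomputable def nextTest (a : (List ℕ × List ℕ) × Bool) : Bool :=
  @decide (IsNextPrefix a.1.1 a.1.2 ∧ returnBit a.1 = a.2) (Classical.dec _)

theorem nextTest_eq_true {q p : List ℕ} {b : Bool} :
    nextTest ((q, p), b) = true ↔ IsNextPrefix q p ∧ returnBit (q, p) = b := by
  simp [nextTest]

theorem Primrec.nextTest : Primrec nextTest := by
  classical
  have h : PrimrecPred fun a : (List ℕ × List ℕ) × Bool =>
      IsNextPrefix a.1.1 a.1.2 ∧ _root_.returnBit a.1 = a.2 :=
    (PrimrecRel.isNextPrefix.comp (Primrec.fst.comp .fst) (Primrec.snd.comp .fst)).and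
      (Primrec.eq.comp (Primrec.returnBit.comp .fst) .snd)
  exact h.decide.of_eq fun a => by simp only [_root_.nextTest]; congr

open SymbolicDynamics.FullShift in
/-- The code `t` of a pair `(u, l)` gives the first `l` letters of `x` translated by the `u`-th
cell. -/
def shiftPrefix {S : Type*} (c : S → ℕ) (x : ℤ × ℤ → S) (t : ℕ) : List ℕ :=
  seqPrefix (configCode c (shift (planeCell t.unpair.1) x)) t.unpair.2

section Coding

open SymbolicDynamics.FullShift

variable {S : Type*} [Finite S] [TopologicalSpace S] [DiscreteTopology S]
  {A : Subshift S (ℤ × ℤ)} {c : S → ℕ}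

/-- The next prefix with sign `b` belongs to some point of `A`, and by minimality it also occurs in
a translate of `x`. Hence a search through `x` alone terminates. -/
theorem IsMinimalSubshift.exists_nextTest (hA : IsMinimalSubshift A)
    (hp : ∀ z ∈ A.carrier, ¬ HorizontallyPeriodic z) (hc : Function.Injective c)
    {x z : ℤ × ℤ → S} (hx : x ∈ A.carrier) (hz : z ∈ A.carrier) (m : ℕ) (b : Bool) :
    ∃ t, nextTest ((seqPrefix (configCode c z) m, shiftPrefix c x t), b) = true := by
  obtain ⟨w, hw, l, hl, hb⟩ := hA.exists_isNextPrefix hp hc hz m b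
  obtain ⟨u, hu⟩ := hA.exists_shift_mem_cylinder hx hw ((Finset.range l).image planeCell)
  rw [mem_cylinder_planeCell hc] at hu
  refine ⟨Nat.pair (Encodable.encode u) l, nextTest_eq_true.2 ?_⟩
  have he : shiftPrefix c x (Nat.pair (Encodable.encode u) l) = seqPrefix (configCode c w) l := by
    simp only [shiftPrefix, Nat.unpair_pair]
    rw [← hu, show planeCell (Encodable.encode u) = u from Denumerable.ofNat_encode u]
  rw [he]
  refine ⟨hl, ?_⟩
  -- Some sign is present and `!b` is excluded, so the bit read off is `b`.
  obtain ⟨b', hb'⟩ := hl.2.1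
  rw [length_seqPrefix] at hb'
  simp only [returnBit, length_seqPrefix]
  cases b <;> cases b' <;> simp_all

/-- A chain of next prefixes of translates of `x` whose signs are a given binary sequence. -/
theorem IsMinimalSubshift.exists_chain (hA : IsMinimalSubshift A)
    (hp : ∀ z ∈ A.carrier, ¬ HorizontallyPeriodic z) (hc : Function.Injective c)
    {x : ℤ × ℤ → S} (hx : x ∈ A.carrier) (s : ℕ → Bool) :
    ∃ (g : ℕ → List ℕ) (hex : ∀ n, ∃ t, nextTest ((g n, shiftPrefix c x t), s n) = true),
      ∀ n, g (n + 1) = shiftPrefix c x (Nat.find (hex n)) := by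
  have hstep : ∀ (q : {q : List ℕ // ∃ z ∈ A.carrier, ∃ m, q = seqPrefix (configCode c z) m})
      (b : Bool), ∃ t, nextTest ((q.1, shiftPrefix c x t), b) = true := by
    rintro ⟨_, z, hz, m, rfl⟩ b
    exact hA.exists_nextTest hp hc hx hz m b
  -- The subtype carries the invariant that each list is a pattern of `A`; this keeps the next
  -- search terminating.
  let g : ℕ → {q : List ℕ // ∃ z ∈ A.carrier, ∃ m, q = seqPrefix (configCode c z) m} := fun n =>
    n.rec ⟨[], x, hx, 0, rfl⟩ fun n q =>
      ⟨shiftPrefix c x (Nat.find (hstep q (s n))), _, A.mapsTo _ hx, _, rfl⟩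
  exact ⟨fun n => (g n).1, fun n => hstep (g n) (s n), fun n => rfl⟩

omit [Finite S] [DiscreteTopology S] in
/-- A chain of next prefixes of translates of `x` converges to a point of the subshift. -/
theorem exists_limit (hc : Function.Injective c) {x : ℤ × ℤ → S} (hx : x ∈ A.carrier)
    {g : ℕ → List ℕ} {t : ℕ → ℕ} (hg : ∀ n, IsNextPrefix (g n) (g (n + 1)))
    (hgt : ∀ n, g (n + 1) = shiftPrefix c x (t n)) :
    ∃ y ∈ A.carrier, ∀ i, configCode c y i = (g (i + 1)).getD i 0 := by
  let z : ℕ → ℤ × ℤ → S := fun n => shift (planeCell (t n).unpair.1) x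
  have hz : ∀ n i, i ≤ n → configCode c (z n) i = (g (i + 1)).getD i 0 := fun n i hi => by
    have h1 := le_length hg (i + 1)
    have h2 := le_length hg (n + 1)
    rw [(isPrefix_of_le hg (Nat.succ_le_succ hi)).getD_eq h1]
    rw [hgt n, shiftPrefix] at h2 ⊢
    rw [length_seqPrefix] at h2
    rw [getD_seqPrefix _ (by omega)]
  -- Diagonal limit: from the `i`-th translate on, the letter at the `i`-th cell no longer changes.
  let y : ℤ × ℤ → S := fun u => z (Encodable.encode u) u
  have hy : ∀ i, configCode c y i = (g (i + 1)).getD i 0 := fun i => by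
    rw [← hz i i le_rfl]
    simp only [configCode, y, Denumerable.encode_ofNat]
  refine ⟨y, A.isClosed.mem_of_tendsto (f := z) (b := Filter.atTop) ?_
    (Filter.Eventually.of_forall fun n => A.mapsTo _ hx), hy⟩
  refine tendsto_pi_nhds.2 fun u => tendsto_nhds_of_eventually_eq ?_
  filter_upwards [Filter.eventually_ge_atTop (Encodable.encode u)] with n hn
  have := (hz n _ hn).trans (hy _).symm
  simp only [configCode, Denumerable.ofNat_encode] at this
  exact hc this

end Coding

/-! ### Computability of the limit and of its signs. -/

section Degree

variable {S : Type*} {c : S → ℕ} {O : Set (ℕ →. ℕ)}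

theorem ComputableIn.shiftPrefix {x : ℤ × ℤ → S} (hx : ComputableIn O (configCode c x)) :
    ComputableIn O (shiftPrefix c x) := by
  have h1 : ComputableIn O fun p : ℕ × ℕ => configCode c x (translateIndex p.1 p.2) :=
    hx.comp Primrec.translateIndex.computableIn₂
  refine (h1.range_map.comp ComputableIn.unpair).of_eq fun t => congrArg Part.some ?_
  exact List.map_congr_left fun i _ => (configCode_shift c x _ i).symm

theorem ComputableIn.seqPrefix {f : ℕ → ℕ} (hf : ComputableIn O f) :
    ComputableIn O (seqPrefix f) :=
  (ComputableIn.range_map (α := ℕ) (f := fun p => f p.2) (hf.comp ComputableIn.snd)).comp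
    (ComputableIn.pair (ComputableIn.const 0) ComputableIn.id)

/-- The limit of a chain found by a computable search is computable. -/
theorem ComputableIn.limit_of_chain {g : ℕ → List ℕ} {e : ℕ → List ℕ} {s : ℕ → Bool}
    {f : ℕ → ℕ} (he : ComputableIn O e) (hs : ComputableIn O s)
    (hex : ∀ n, ∃ t, nextTest ((g n, e t), s n) = true)
    (hg : ∀ n, g (n + 1) = e (Nat.find (hex n))) (hf : ∀ i, f i = (g (i + 1)).getD i 0) :
    ComputableIn O f := by
  have hP : ComputableIn O fun a : (ℕ × List ℕ) × ℕ => nextTest ((a.1.2, e a.2), s a.1.1) :=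
    Primrec.nextTest.computableIn.comp
      (((Primrec.snd.comp Primrec.fst).computableIn.pair (he.comp ComputableIn.snd)).pair
        (hs.comp (Primrec.fst.comp Primrec.fst).computableIn))
  have hgc : ComputableIn O g := ComputableIn.of_find hP he hex hg
  have h1 : ComputableIn O fun i => (g (i + 1)).getD i 0 :=
    ComputableIn.comp (f := fun p : List ℕ × ℕ => p.1.getD p.2 0)
      (Primrec.list_getD 0).computableIn ((hgc.comp ComputableIn.succ).pair ComputableIn.id)
  exact h1.of_eq fun i => congrArg Part.some (hf i).symm

/-- The signs of a chain of next prefixes are computable from its limit. -/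
theorem ComputableIn.sign_of_limit {g : ℕ → List ℕ} {f : ℕ → ℕ} (hf : ComputableIn O f)
    (hg : ∀ n, IsNextPrefix (g n) (g (n + 1))) (hgf : ∀ n, g n = _root_.seqPrefix f (g n).length) :
    ComputableIn O fun n => returnBit (g n, g (n + 1)) := by
  obtain ⟨D, hD, hDiff⟩ : ∃ D : List ℕ × List ℕ → Bool,
      Primrec D ∧ ∀ q p, D (q, p) = true ↔ IsNextPrefix q p := by
    obtain ⟨_, h⟩ := PrimrecRel.isNextPrefix
    exact ⟨_, h, fun q p => decide_eq_true_iff⟩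
  have he : ComputableIn O (_root_.seqPrefix f) := hf.seqPrefix
  have hP : ComputableIn O fun a : (ℕ × List ℕ) × ℕ => D (a.1.2, _root_.seqPrefix f a.2) :=
    hD.computableIn.comp
      ((Primrec.snd.comp Primrec.fst).computableIn.pair (he.comp ComputableIn.snd))
  have hex : ∀ n, ∃ t, D (g n, _root_.seqPrefix f t) = true := fun n =>
    ⟨(g (n + 1)).length, by rw [← hgf]; exact (hDiff _ _).2 (hg n)⟩
  -- The search sees only prefixes of `f`; by uniqueness the one it finds is `g (n + 1)`, whatever
  -- its sign.
  have hgc : ComputableIn O g := ComputableIn.of_find hP he hex fun n => by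
    refine (hg n).unique ((hDiff _ _).1 (Nat.find_spec (hex n))) ?_
    rw [hgf (n + 1)]
    exact (le_total _ _).imp (seqPrefix_isPrefix f) (seqPrefix_isPrefix f)
  exact Primrec.returnBit.computableIn.comp (hgc.pair (hgc.comp ComputableIn.succ))

theorem ComputableIn.of_mem_toNat {s : ℕ → Bool} :
    ComputableIn {((fun n => (s n).toNat : ℕ → ℕ) : ℕ →. ℕ)} s := by
  have h1 : ComputableIn {((fun n => (s n).toNat : ℕ → ℕ) : ℕ →. ℕ)} fun n => (s n).toNat :=
    RecursiveIn.oracle _ (Set.mem_singleton _)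
  have h2 : Primrec fun n : ℕ => decide (n = 1) :=
    (Primrec.eq.comp Primrec.id (Primrec.const 1)).decide
  refine (h2.computableIn.comp h1).of_eq fun n => congrArg Part.some ?_
  cases h : s n <;> simp [h]

end Degree

theorem mainTheorem5 {S : Type*} [Finite S] [TopologicalSpace S] [DiscreteTopology S]
    (A : SymbolicDynamics.FullShift.Subshift S (ℤ × ℤ)) (hA : IsMinimalSubshift A) :
    ((∀ z ∈ A.carrier, ¬ HorizontallyPeriodic z) ↔
        ∃ z ∈ A.carrier, ¬ HorizontallyPeriodic z) ∧
      ((∀ z ∈ A.carrier, ¬ HorizontallyPeriodic z) →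
        ∀ x ∈ A.carrier, ∀ d : TuringDegree, d ∈ Set.range seqDegree →
          configDegree x ≤ d → ∃ y ∈ A.carrier, configDegree y = d) := by
  refine ⟨⟨fun h => ?_, ?_⟩, ?_⟩
  · obtain ⟨z, hz⟩ := hA.1
    exact ⟨z, hz, h z hz⟩
  · rintro ⟨z, hz, hzp⟩ w hw hwp
    exact hzp (hA.horizontallyPeriodic_of_exists hw hz hwp)
  · rintro hp x hx _ ⟨s, rfl⟩ hxs
    have hc : Function.Injective fun a : S => (Finite.equivFin S a : ℕ) :=
      fun _ _ h => (Finite.equivFin S).injective (Fin.ext h)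
    obtain ⟨g, hex, hg⟩ := hA.exists_chain hp hc hx s
    have hnext : ∀ n, IsNextPrefix (g n) (g (n + 1)) ∧ returnBit (g n, g (n + 1)) = s n :=
      fun n => by
        rw [hg n]
        exact nextTest_eq_true.1 (Nat.find_spec (hex n))
    obtain ⟨y, hy, hyg⟩ := exists_limit hc hx (fun n => (hnext n).1) hg
    refine ⟨y, hy, le_antisymm ?_ ?_⟩
    -- `hxs` makes `x` computable from `s`, so the oracle `s` alone runs the search in `x`.
    · exact ComputableIn.limit_of_chain (ComputableIn.shiftPrefix hxs)
        ComputableIn.of_mem_toNat hex hg hyg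
    · have h1 := ComputableIn.sign_of_limit
        (RecursiveIn.oracle _ (Set.mem_singleton _) : ComputableIn
          {((configCode (fun a : S => (Finite.equivFin S a : ℕ)) y : ℕ → ℕ) : ℕ →. ℕ)}
          (configCode (fun a : S => (Finite.equivFin S a : ℕ)) y))
        (fun n => (hnext n).1) (eq_seqPrefix_of_chain (fun n => (hnext n).1) hyg)
      have h2 : Primrec fun b : Bool => b.toNat :=
        (Primrec.cond .id (.const 1) (.const 0)).of_eq fun b => by cases b <;> rfl
      refine (h2.computableIn.comp h1).of_eq fun n => ?_
      simp only [(hnext n).2]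
      rfl
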